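/- Young diagrams are finite sets of boxes $Y=\{(i,j): 1\le i\le k,\ 1\le j\le \lambda_i\}$ with $\lambda_1\ge\dots\ge\lambda_k\ge 0$. The hook of a box $(i,j)\in Y$ consists of $(i,j)$, the boxes $(i',j)\in Y$ with $i'>i$, and the boxes $(i,j')\in Y$ with $j'>j$. Removing this hook from $Y$ means deleting its boxes and then moving every box $(i',j')$ with $i'>i$ and $j'>j$ to $(i'-1,j'-1)$; the result is again a Young diagram, contained in $Y$. For positive integers $m,n$, the impartial game $\mathrm{MHRG}(m,n)$ is defined as follows. The starting position is the rectangle $Y_{m,n}=\{(i,j):1\le i\le m,\ 1\le j\le n\}$, in which the box $(i,j)$ carries the number $\alpha_{m,n}(i,j)=\min\{j-i+m,\ i-j+n\}$; in every position $Y\subseteq Y_{m,n}$ the box at $(i,j)$ carries the number $\alpha_{m,n}(i,j)$. In a position $Y$, the player to move chooses a box of $Y$ and removes its hook $h$; let $\mathcal A(h)$ be the multiset of the numbers in the boxes of $h$. As long as the current diagram has a box whose hook $h'$ satisfies $\mathcal A(h')=\mathcal A(h)$, the player must choose such a box and remove its hook as well; when there is no such box, the turn ends, and the current diagram is passed to the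 other player. The player who makes the empty diagram wins. The positions of $\mathrm{MHRG}(m,n)$ are the diagrams reachable from $Y_{m,n}$ by finitely many (possibly zero) turns. The $\mathcal G$-value of a position $Y$ is defined recursively by $$\mathcal G(Y)=\mathrm{mex}\{\mathcal G(Y') : Y' \text{ can be reached from } Y \text{ in one turn}\},$$ where $\mathrm{mex}\,T=\min(\mathbb Z_{\ge 0}\setminus T)$. Let $n\ge 2$. In $\mathrm{MHRG}(2,n)$, the $\mathcal G$-value of the starting position $Y_{2,n}$ is $$\mathcal G(Y_{2,n})=\begin{cases}3 & \text{if } n\in\{2,3\},\\ 2 & \text{if } n\notin\{2,3\} \text{ and } n\equiv 2 \text{ or } 3 \pmod 8,\\ 1 & \text{otherwise.}\end{cases}$$ -/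

import Mathlib

/-! ## Impartial games and their 𝒢-values -/

/-- An impartial game with a starting position: `Move p q` says that `q` is an option of `p`.
Every position has finitely many options and every play ends. -/
structure ImpartialGame where
  Pos : Type
  Move : Pos → Pos → Prop
  start : Pos
  finite_options : ∀ p, {q | Move p q}.Finite
  wf : WellFounded (fun q p => Move p q)

/-- The minimal excluded natural number of a (proper) subset of `ℕ`. -/
noncomputable def mex (S : Set ℕ) : ℕ := sInf Sᶜ

namespace ImpartialGame

/-- The 𝒢-value of a position: the `mex` of the 𝒢-values of its options. -/
noncomputable def gValue (G : ImpartialGame) : G.Pos → ℕ :=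
  G.wf.fix fun p ih => mex {k | ∃ (q : G.Pos) (h : G.Move p q), ih q h = k}

/-- The defining recursion of the 𝒢-value. -/
theorem gValue_eq (G : ImpartialGame) (p : G.Pos) :
    G.gValue p = mex (G.gValue '' {q | G.Move p q}) := by
  unfold gValue
  rw [WellFounded.fix_eq]
  congr 1
  ext k
  simp [Set.mem_image]

end ImpartialGame

/-! ## Young diagrams, hooks and hook removal

Mathlib's Young diagrams have rows and columns numbered from `0`, so the cell `(i, j)` below is the
box usually called `(i + 1, j + 1)`. -/

namespace HookGame

/-- The hook of the box `c` in `Y`: the box itself, the boxes of `Y` below it in its column, and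
the boxes of `Y` to the right of it in its row. -/
def hook (Y : YoungDiagram) (c : ℕ × ℕ) : Finset (ℕ × ℕ) :=
  Y.cells.filter fun d => d = c ∨ (c.1 < d.1 ∧ d.2 = c.2) ∨ (d.1 = c.1 ∧ c.2 < d.2)

/-- When the hook of `c` is removed, a box strictly below and strictly to the right of `c` moves
one step diagonally to the upper left; the other remaining boxes stay in place. -/
def slide (c d : ℕ × ℕ) : ℕ × ℕ :=
  if c.1 < d.1 ∧ c.2 < d.2 then (d.1 - 1, d.2 - 1) else d

theorem mem_slide_image (Y : YoungDiagram) (c e : ℕ × ℕ) :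
    e ∈ (Y.cells \ hook Y c).image (slide c) ↔
      (e ∈ Y ∧ (e.1 < c.1 ∨ e.2 < c.2)) ∨ (c.1 ≤ e.1 ∧ c.2 ≤ e.2 ∧ (e.1 + 1, e.2 + 1) ∈ Y) := by
  obtain ⟨a, b⟩ := c
  obtain ⟨x, y⟩ := e
  simp only [Finset.mem_image, Finset.mem_sdiff, hook, Finset.mem_filter, YoungDiagram.mem_cells,
    Prod.exists, Prod.mk.injEq, slide]
  constructor
  · rintro ⟨i, j, ⟨hY, hh⟩, hs⟩
    split_ifs at hs with hc
    · obtain ⟨rfl, rfl⟩ := Prod.mk.injEq .. ▸ hs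
      right
      refine ⟨by omega, by omega, ?_⟩
      have h1 : i - 1 + 1 = i := by omega
      have h2 : j - 1 + 1 = j := by omega
      rw [h1, h2]
      exact hY
    · obtain ⟨rfl, rfl⟩ := Prod.mk.injEq .. ▸ hs
      left
      refine ⟨hY, ?_⟩
      by_contra hcon
      apply hh
      refine ⟨hY, ?_⟩
      omega
  · rintro (⟨hY, h⟩ | ⟨h1, h2, hY⟩)
    · refine ⟨x, y, ⟨hY, ?_⟩, ?_⟩
      · rintro ⟨-, h'⟩
        omega
      · rw [if_neg (by omega)]
    · refine ⟨x + 1, y + 1, ⟨hY, ?_⟩, ?_⟩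
      · rintro ⟨-, h'⟩
        omega
      · rw [if_pos (by omega)]
        simp

/-- The Young diagram obtained from `Y` by removing the hook of the box `c`. -/
def removeHook (Y : YoungDiagram) (c : ℕ × ℕ) : YoungDiagram where
  cells := (Y.cells \ hook Y c).image (slide c)
  isLowerSet := by
    rintro ⟨x, y⟩ ⟨u, v⟩ hle h
    rw [Finset.mem_coe, mem_slide_image] at h ⊢
    obtain ⟨hu, hv⟩ := Prod.mk_le_mk.mp hle
    by_cases hc : u < c.1 ∨ v < c.2
    · left
      refine ⟨?_, hc⟩
      rcases h with ⟨hY, -⟩ | ⟨-, -, hY⟩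
      · exact Y.up_left_mem hu hv hY
      · exact Y.up_left_mem (by simp only; omega) (by simp only; omega) hY
    · right
      rcases h with ⟨-, h⟩ | ⟨-, -, hY⟩
      · simp only at h
        omega
      · exact ⟨by simp only; omega, by simp only; omega,
          Y.up_left_mem (by simp only; omega) (by simp only; omega) hY⟩

theorem removeHook_le (Y : YoungDiagram) (c : ℕ × ℕ) : removeHook Y c ≤ Y := by
  rintro ⟨x, y⟩ h
  rcases (mem_slide_image Y c _).mp h with ⟨hY, -⟩ | ⟨-, -, hY⟩
  · exact hY
  · exact Y.up_left_mem (by simp only; omega) (by simp only; omega) hY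

theorem card_removeHook_lt {Y : YoungDiagram} {c : ℕ × ℕ} (hc : c ∈ Y) :
    (removeHook Y c).card < Y.card := by
  refine lt_of_le_of_lt Finset.card_image_le (Finset.card_lt_card ?_)
  refine Finset.sdiff_ssubset (Finset.filter_subset _ _) ⟨c, ?_⟩
  simp [hook, hc]

/-! ## The rules of the Multiple Hook Removing Game

A numbering is given as a function `α : ℕ × ℕ → ℕ`; the game started at `Y` only reads its values
on the boxes of `Y`. -/

/-- The multiset of the numbers in the hook of the box `c` of `Y`. -/
def hookNumbers (α : ℕ × ℕ → ℕ) (Y : YoungDiagram) (c : ℕ × ℕ) : Multiset ℕ :=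
  (hook Y c).val.map α

/-- `Continuation α A Y Z`: while some hook has the multiset of numbers `A`, one such hook has to be
removed; starting at `Y`, this can lead to `Z`, where no hook with multiset `A` is left. -/
inductive Continuation (α : ℕ × ℕ → ℕ) (A : Multiset ℕ) : YoungDiagram → YoungDiagram → Prop
  | done (Y : YoungDiagram) (h : ∀ c ∈ Y, hookNumbers α Y c ≠ A) : Continuation α A Y Y
  | step (Y Z : YoungDiagram) (c : ℕ × ℕ) (hc : c ∈ Y) (hA : hookNumbers α Y c = A)
      (h : Continuation α A (removeHook Y c) Z) : Continuation α A Y Z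

/-- A complete turn leading from `Y` to `Z`: the player chooses a box of `Y`, removes its hook, and
then keeps removing hooks with the same multiset of numbers as long as there are any. -/
def Turn (α : ℕ × ℕ → ℕ) (Y Z : YoungDiagram) : Prop :=
  ∃ c ∈ Y, Continuation α (hookNumbers α Y c) (removeHook Y c) Z

theorem Continuation.le {α : ℕ × ℕ → ℕ} {A : Multiset ℕ} {Y Z : YoungDiagram}
    (h : Continuation α A Y Z) : Z ≤ Y := by
  induction h with
  | done Y h => exact le_rfl
  | step Y Z c hc hA h ih => exact ih.trans (removeHook_le Y c)

theorem Turn.le {α : ℕ × ℕ → ℕ} {Y Z : YoungDiagram} (h : Turn α Y Z) : Z ≤ Y := by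
  obtain ⟨c, -, h⟩ := h
  exact h.le.trans (removeHook_le Y c)

theorem Turn.card_lt {α : ℕ × ℕ → ℕ} {Y Z : YoungDiagram} (h : Turn α Y Z) : Z.card < Y.card := by
  obtain ⟨c, hc, h⟩ := h
  exact lt_of_le_of_lt (Finset.card_le_card h.le) (card_removeHook_lt hc)

/-- The Multiple Hook Removing Game with starting position `Ys`, numbered by `α`. Its positions are
the Young diagrams that can be reached from `Ys` by a sequence of turns. -/
def game (Ys : YoungDiagram) (α : ℕ × ℕ → ℕ) : ImpartialGame where
  Pos := {Y : YoungDiagram // Relation.ReflTransGen (Turn α) Ys Y}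
  Move := fun Y Z => Turn α Y.1 Z.1
  start := ⟨Ys, Relation.ReflTransGen.refl⟩
  finite_options := by
    rintro ⟨Y, -⟩
    refine Set.Finite.of_finite_image
      (f := fun Z : {Y : YoungDiagram // Relation.ReflTransGen (Turn α) Ys Y} => Z.1.cells)
      ((Y.cells.powerset.finite_toSet).subset ?_) ?_
    · rintro _ ⟨Z, hZ, rfl⟩
      exact Finset.mem_coe.mpr (Finset.mem_powerset.mpr (Turn.le hZ))
    · intro Z _ Z' _ h
      exact Subtype.ext (YoungDiagram.ext h)
  wf := Subrelation.wf (fun h => Turn.card_lt h)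
    (InvImage.wf (fun Y : {Y : YoungDiagram // Relation.ReflTransGen (Turn α) Ys Y} => Y.1.card)
      Nat.lt_wfRel.wf)

/-! ## Rectangles with the unimodal numbering -/

/-- The rectangular Young diagram with `m` rows and `n` columns. -/
def rectangle (m n : ℕ) : YoungDiagram where
  cells := Finset.range m ×ˢ Finset.range n
  isLowerSet := by
    rintro ⟨x, y⟩ ⟨u, v⟩ hle h
    obtain ⟨hu, hv⟩ := Prod.mk_le_mk.mp hle
    simp only [Finset.coe_product, Finset.coe_range, Set.mem_prod, Set.mem_Iio] at h ⊢
    omega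

/-- The unimodal numbering `(i, j) ↦ min (j - i + m) (i - j + n)` of the boxes of the `m × n`
rectangle. -/
def unimodal (m n : ℕ) (c : ℕ × ℕ) : ℕ := min (c.2 + m - c.1) (c.1 + n - c.2)

/-- On the rectangle, no subtraction in `unimodal` is truncated, and the numbers are positive. -/
theorem unimodal_spec {m n : ℕ} {c : ℕ × ℕ} (hc : c ∈ rectangle m n) :
    (unimodal m n c : ℤ) = min ((c.2 : ℤ) - c.1 + m) ((c.1 : ℤ) - c.2 + n) ∧
      0 < unimodal m n c := by
  have h : c.1 < m ∧ c.2 < n := by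
    have h' : c ∈ Finset.range m ×ˢ Finset.range n := hc
    simpa using h'
  unfold unimodal
  omega

end HookGame

/-- The game MHRG(m, n): the Multiple Hook Removing Game whose starting position is the `m × n`
rectangle with the unimodal numbering. -/
def MHRG (m n : ℕ) : ImpartialGame :=
  HookGame.game (HookGame.rectangle m n) (HookGame.unimodal m n)

/-! A diagram with at most two rows is recorded by its first-column hook lengths, a pair of distinct
numbers in `{0, …, M}` with `M = n + 1`. Removing a hook replaces one member `s` by a smaller `t`
different from the other member (`hookCorner_spec`), and the hook occupies the shifted contents `t,
…, s - 1`. As the numbering is symmetric and unimodal, two hooks carry the same multiset exactly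
when their content intervals agree or are exchanged by the reflection at `M` (`segment_eq_iff`). So
after `s → t` the turn can only continue with `M - t → M - s`.

It follows that pairs with sum `M` or with a member `M / 2` never occur, and that a turn either
lowers one member or, for sums above `M`, reflects the whole pair (`turn_twoRow_iff`). Closing the
gap at `M / 2` turns this into a game on pairs in `{0, …, 2k - 1}` with `k = n / 2 + 1`, pairs of
sum `2k - 1` being forbidden (`turn_pairDiagram_iff`). The start is `{2k - 1, 2k - 2}`.

For this game the pairs of value `0` and `1`, and of value `2` when `k ≡ 2 mod 4`, are given
explicitly. Each class is a partial matching of `{0, …, 2k - 1}`: two pairs sharing a member would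
be joined by a lowering move. Conversely, a pair outside the class usually reaches it by replacing
one member by the partner of the other; in the remaining cases reflection helps, or the pair has a
smaller value. The start lies in class `1` unless `k ≡ 2 mod 4`, that is `n ≡ 2, 3 mod 8`; then it
lies in class `2`, except for `k = 2`, where it is the only pair left over and has value `3`. -/

theorem mex_eq_iff {S : Set ℕ} (hS : S.Finite) (v : ℕ) :
    mex S = v ↔ v ∉ S ∧ ∀ u < v, u ∈ S := by
  have hne : (Sᶜ).Nonempty := hS.infinite_compl.nonempty
  constructor
  · rintro rfl
    exact ⟨Nat.sInf_mem hne, fun u hu => by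
      by_contra h
      exact Nat.notMem_of_lt_sInf hu h⟩
  · rintro ⟨h1, h2⟩
    refine le_antisymm (Nat.sInf_le h1) ?_
    by_contra! h
    exact Nat.sInf_mem hne (h2 _ h)

/-- Sets `S 0, …, S V` that behave like the sets of positions of value `0, …, V` are those sets. -/
theorem ImpartialGame.gValue_eq_iff_mem (G : ImpartialGame) (V : ℕ) (S : ℕ → Set G.Pos)
    (hdisj : ∀ v ≤ V, ∀ u < v, ∀ p ∈ S v, p ∉ S u)
    (hindep : ∀ v ≤ V, ∀ p ∈ S v, ∀ q, G.Move p q → q ∉ S v)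
    (habs : ∀ v ≤ V, ∀ p, (∀ u ≤ v, p ∉ S u) → ∃ q, G.Move p q ∧ q ∈ S v) (p : G.Pos) :
    ∀ v ≤ V, G.gValue p = v ↔ p ∈ S v := by
  induction p using G.wf.induction with
  | _ p ih =>
    have hmex (v : ℕ) : G.gValue p = v ↔
        (∀ q, G.Move p q → G.gValue q ≠ v) ∧ ∀ u < v, ∃ q, G.Move p q ∧ G.gValue q = u := by
      rw [G.gValue_eq, mex_eq_iff ((G.finite_options p).image _)]
      simp
    have hback : ∀ v ≤ V, p ∈ S v → G.gValue p = v := by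
      intro v hv hp
      rw [hmex]
      refine ⟨fun q hq h => hindep v hv p hp q hq ((ih q hq v hv).1 h), fun u hu => ?_⟩
      obtain ⟨q, hq, hqS⟩ := habs u (hu.le.trans hv) p
        fun w hw => hdisj v hv w (hw.trans_lt hu) p hp
      exact ⟨q, hq, (ih q hq u (hu.le.trans hv)).2 hqS⟩
    refine fun v hv => ⟨fun h => ?_, hback v hv⟩
    by_contra hp
    obtain ⟨q, hq, hqS⟩ := habs v hv p fun u hu hpu => by
      have := hback u (hu.trans hv) hpu
      rw [h] at this
      exact hp (this ▸ hpu)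
    exact ((hmex v).1 h).1 q hq ((ih q hq v hv).2 hqS)

/-! ### Two-row diagrams as pairs of first-column hook lengths -/

namespace HookGame

/-- The diagram with at most two rows whose first-column hook lengths are `x` and `y`: for `y < x`
its rows have lengths `x - 1` and `y`. -/
def twoRow (x y : ℕ) : YoungDiagram where
  cells := (Finset.range 2 ×ˢ Finset.range (x + y)).filter fun c =>
    (c.1 = 0 ∧ (c.2 + 1 < x ∨ c.2 + 1 < y)) ∨ (c.2 < x ∧ c.2 < y)
  isLowerSet := by
    rintro ⟨i, j⟩ ⟨u, v⟩ hle h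
    obtain ⟨hu, hv⟩ := Prod.mk_le_mk.mp hle
    simp only [Finset.coe_filter, Finset.mem_product, Finset.mem_range, Set.mem_ofPred_eq] at h ⊢
    omega

theorem mem_twoRow {x y i j : ℕ} : (i, j) ∈ twoRow x y ↔
    (i = 0 ∧ (j + 1 < x ∨ j + 1 < y)) ∨ (i < 2 ∧ j < x ∧ j < y) := by
  rw [← YoungDiagram.mem_cells]
  simp only [twoRow, Finset.mem_filter, Finset.mem_product, Finset.mem_range]
  omega

theorem twoRow_comm (x y : ℕ) : twoRow x y = twoRow y x := by
  ext ⟨i, j⟩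
  simp only [YoungDiagram.mem_cells, mem_twoRow]
  omega

theorem twoRow_inj {x y x' y' : ℕ} (h : y < x) (h' : y' < x') (he : twoRow x y = twoRow x' y') :
    x = x' ∧ y = y' := by
  have key (i j : ℕ) : _ ↔ _ := (mem_twoRow (x := x) (y := y) (i := i) (j := j)).symm.trans
    ((he ▸ Iff.rfl : (i, j) ∈ twoRow x y ↔ (i, j) ∈ twoRow x' y').trans mem_twoRow)
  have h1 := key 0 (x - 2)
  have h2 := key 0 (x' - 2)
  have h3 := key 1 (y - 1)
  have h4 := key 1 (y' - 1)
  have h5 := key 1 y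
  have h6 := key 1 y'
  omega

theorem mem_removeHook {Y : YoungDiagram} {a b i j : ℕ} : (i, j) ∈ removeHook Y (a, b) ↔
    ((i, j) ∈ Y ∧ (i < a ∨ j < b)) ∨ (a ≤ i ∧ b ≤ j ∧ (i + 1, j + 1) ∈ Y) :=
  mem_slide_image Y (a, b) (i, j)

/-- The numbers in a hook whose boxes have the shifted contents `t, …, s - 1`. -/
def segment (M t s : ℕ) : Multiset ℕ := (Finset.Ico t s).val.map fun e => min (e + 1) (M - e)

theorem segment_reflect {M t s : ℕ} (hs : s ≤ M) : segment M (M - s) (M - t) = segment M t s := by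
  have himg : (Finset.Ico t s).image (fun e => M - 1 - e) = Finset.Ico (M - s) (M - t) := by
    ext e
    simp only [Finset.mem_image, Finset.mem_Ico]
    exact ⟨by rintro ⟨a, ha, rfl⟩; omega, fun h => ⟨M - 1 - e, by omega, by omega⟩⟩
  unfold segment
  rw [← himg, Finset.image_val_of_injOn, Multiset.map_map]
  · refine Multiset.map_congr rfl fun e he => ?_
    have he' : e ∈ Finset.Ico t s := he
    rw [Finset.mem_Ico] at he'
    simp only [Function.comp_apply]
    omega
  · intro a ha b hb hab
    simp only [Finset.coe_Ico, Set.mem_Ico] at ha hb hab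
    omega

/-- The multiset determines the length `s - t` and, through its least element, `min t (M - s)`; this
fixes the interval up to reflection. -/
theorem segment_eq_iff {M t s t' s' : ℕ} (ht : t < s) (hs : s ≤ M) (ht' : t' < s') (hs' : s' ≤ M) :
    segment M t s = segment M t' s' ↔ (t = t' ∧ s = s') ∨ (t' + s = M ∧ s' + t = M) := by
  constructor
  · intro h
    have hcard := congrArg Multiset.card h
    simp only [segment, Multiset.card_map, Finset.card_val, Nat.card_Ico] at hcard
    have hle {a b c d : ℕ} (he : segment M a b = segment M c d) (e : ℕ) (h1 : a ≤ e)
        (h2 : e < b) : min c (M - d) ≤ e ∧ (d ≤ M → min c (M - d) + 1 ≤ M - e) := by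
      have : min (e + 1) (M - e) ∈ segment M a b :=
        Multiset.mem_map.2 ⟨e, Finset.mem_Ico.2 ⟨h1, h2⟩, rfl⟩
      rw [he] at this
      obtain ⟨f, hf, hfe⟩ := Multiset.mem_map.1 this
      have hf2 : f ∈ Finset.Ico c d := hf
      rw [Finset.mem_Ico] at hf2
      clear this he hf h hcard
      omega
    have h1 := (hle h t le_rfl ht).1
    have h2 := (hle h (s - 1) (by omega) (by omega)).2 hs'
    have h3 := (hle h.symm t' le_rfl ht').1
    have h4 := (hle h.symm (s' - 1) (by omega) (by omega)).2 hs
    omega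
  · rintro (⟨rfl, rfl⟩ | ⟨h1, h2⟩)
    · rfl
    · rw [← segment_reflect hs]
      congr 1 <;> omega

theorem hookNumbers_eq_segment {n : ℕ} {Y : YoungDiagram} {c : ℕ × ℕ} {t s : ℕ}
    (hrow : ∀ d ∈ Y, d.1 < 2)
    (hinj : ∀ d ∈ hook Y c, ∀ d' ∈ hook Y c, d.2 + 1 - d.1 = d'.2 + 1 - d'.1 → d = d')
    (himg : ∀ e, (∃ d ∈ hook Y c, d.2 + 1 - d.1 = e) ↔ t ≤ e ∧ e < s) :
    hookNumbers (unimodal 2 n) Y c = segment (n + 1) t s := by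
  have h : (hook Y c).image (fun d => d.2 + 1 - d.1) = Finset.Ico t s := by
    ext e
    rw [Finset.mem_image, himg, Finset.mem_Ico]
  unfold segment hookNumbers
  rw [← h, Finset.image_val_of_injOn, Multiset.map_map]
  · refine Multiset.map_congr rfl fun d hd => ?_
    have := hrow d (Finset.mem_filter.1 hd).1
    simp only [Function.comp_apply, unimodal]
    omega
  · exact fun d hd d' hd' => hinj d hd d' hd'

theorem mem_hook {Y : YoungDiagram} {a b i j : ℕ} : (i, j) ∈ hook Y (a, b) ↔
    (i, j) ∈ Y ∧ ((i = a ∧ j = b) ∨ (a < i ∧ j = b) ∨ (i = a ∧ b < j)) := by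
  simp [hook]

/-- The box whose hook removal replaces `s` by `t` in the pair `{s, o}`. -/
def hookCorner (s o t : ℕ) : ℕ × ℕ := if s < o then (1, t) else if o < t then (0, t - 1) else (0, t)

theorem hookCorner_spec (n : ℕ) {s o t : ℕ} (hso : s ≠ o) (hts : t < s) (hto : t ≠ o) :
    hookCorner s o t ∈ twoRow s o ∧ removeHook (twoRow s o) (hookCorner s o t) = twoRow t o ∧
      hookNumbers (unimodal 2 n) (twoRow s o) (hookCorner s o t) = segment (n + 1) t s := by
  unfold hookCorner
  split_ifs with h1 h2
  all_goals
    refine ⟨mem_twoRow.2 (by omega), ?_, hookNumbers_eq_segment ?_ ?_ ?_⟩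
    · ext ⟨i, j⟩
      simp only [YoungDiagram.mem_cells, mem_removeHook, mem_twoRow]
      omega
    · rintro ⟨i, j⟩ h
      rw [mem_twoRow] at h
      simp only
      omega
    · rintro ⟨i, j⟩ h ⟨i', j'⟩ h' he
      rw [mem_hook, mem_twoRow] at h h'
      simp only [Prod.mk.injEq] at he ⊢
      omega
    intro e
    refine ⟨?_, fun he => ?_⟩
    · rintro ⟨⟨i, j⟩, h, rfl⟩
      rw [mem_hook, mem_twoRow] at h
      simp only
      omega
  · exact ⟨(1, e), by rw [mem_hook, mem_twoRow]; omega, by simp⟩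
  · exact ⟨(0, e - 1), by rw [mem_hook, mem_twoRow]; omega, by simp only; omega⟩
  -- When `t < o` the hook has a box in the lower row, and that box supplies the content `t`; all
  -- other contents come from the upper row.
  · by_cases het : e = t ∧ t < o
    · exact ⟨(1, e), by rw [mem_hook, mem_twoRow]; omega, by simp⟩
    · exact ⟨(0, e - 1), by rw [mem_hook, mem_twoRow]; omega, by simp only; omega⟩

theorem exists_eq_hookCorner {x y : ℕ} (hxy : x ≠ y) {c : ℕ × ℕ} (hc : c ∈ twoRow x y) :
    (∃ t, t < x ∧ t ≠ y ∧ c = hookCorner x y t) ∨ ∃ t, t < y ∧ t ≠ x ∧ c = hookCorner y x t := by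
  wlog h : y < x generalizing x y
  · rw [or_comm]
    exact this hxy.symm (twoRow_comm x y ▸ hc) (by omega)
  obtain ⟨i, j⟩ := c
  rw [mem_twoRow] at hc
  by_cases hi : i = 0
  · left
    by_cases hj : j < y
    · exact ⟨j, by omega, by omega, by simp [hookCorner, h.not_gt, hj.not_gt, hi]⟩
    · exact ⟨j + 1, by omega, by omega, by
        simp [hookCorner, h.not_gt, show y < j + 1 by omega, hi]⟩
  · right
    exact ⟨j, by omega, by omega, by simp [hookCorner, h]; omega⟩

end HookGame

/-! ### Complete turns in terms of pairs -/

namespace HookGame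

/-- `s` is replaced by `t` in the pair `{x, y}`, and `o` is the other member of the pair. -/
def Replaces (x y s o t : ℕ) : Prop := ((s = x ∧ o = y) ∨ (s = y ∧ o = x)) ∧ t < s ∧ t ≠ o

theorem exists_hook_iff (n : ℕ) {x y : ℕ} (hxy : x ≠ y) (P : Multiset ℕ → YoungDiagram → Prop) :
    (∃ c ∈ twoRow x y, P (hookNumbers (unimodal 2 n) (twoRow x y) c)
      (removeHook (twoRow x y) c)) ↔
    ∃ s o t, Replaces x y s o t ∧ P (segment (n + 1) t s) (twoRow t o) := by
  constructor
  · rintro ⟨c, hc, hP⟩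
    rcases exists_eq_hookCorner hxy hc with ⟨t, h1, h2, rfl⟩ | ⟨t, h1, h2, rfl⟩
    · obtain ⟨-, h3, h4⟩ := hookCorner_spec n hxy h1 h2
      exact ⟨x, y, t, ⟨by simp, h1, h2⟩, by rwa [h3, h4] at hP⟩
    · obtain ⟨-, h3, h4⟩ := hookCorner_spec n hxy.symm h1 h2
      rw [twoRow_comm y x] at h3 h4
      exact ⟨y, x, t, ⟨by simp, h1, h2⟩, by rwa [h3, h4] at hP⟩
  · rintro ⟨s, o, t, ⟨⟨rfl, rfl⟩ | ⟨rfl, rfl⟩, h1, h2⟩, hP⟩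
    · obtain ⟨h, h3, h4⟩ := hookCorner_spec n hxy h1 h2
      exact ⟨_, h, by rwa [h3, h4]⟩
    · obtain ⟨h, h3, h4⟩ := hookCorner_spec n hxy.symm h1 h2
      rw [twoRow_comm s o] at h h3 h4
      exact ⟨_, h, by rwa [h3, h4]⟩

theorem turn_twoRow_iff_replaces {n x y : ℕ} (hxy : x ≠ y) {Z : YoungDiagram} :
    Turn (unimodal 2 n) (twoRow x y) Z ↔ ∃ s o t, Replaces x y s o t ∧
      Continuation (unimodal 2 n) (segment (n + 1) t s) (twoRow t o) Z :=
  exists_hook_iff n hxy fun A Y => Continuation (unimodal 2 n) A Y Z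

theorem continuation_iff {α : ℕ × ℕ → ℕ} {A : Multiset ℕ} {Y Z : YoungDiagram} :
    Continuation α A Y Z ↔ (¬ (∃ c ∈ Y, hookNumbers α Y c = A) ∧ Z = Y) ∨
      ∃ c ∈ Y, hookNumbers α Y c = A ∧ Continuation α A (removeHook Y c) Z := by
  constructor
  · intro h
    cases h with
    | done _ h => exact Or.inl ⟨by simpa using h, rfl⟩
    | step _ _ c hc hA h => exact Or.inr ⟨c, hc, hA, h⟩
  · rintro (⟨h, rfl⟩ | ⟨c, hc, hA, h⟩)
    · exact .done _ (by simpa using h)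
    · exact .step _ _ c hc hA h

theorem continuation_twoRow_iff {n x y : ℕ} {A : Multiset ℕ} (hxy : x ≠ y) {Z : YoungDiagram} :
    Continuation (unimodal 2 n) A (twoRow x y) Z ↔
      (¬ (∃ s o t, Replaces x y s o t ∧ segment (n + 1) t s = A) ∧ Z = twoRow x y) ∨
      ∃ s o t, Replaces x y s o t ∧ segment (n + 1) t s = A ∧
        Continuation (unimodal 2 n) A (twoRow t o) Z := by
  rw [continuation_iff, exists_hook_iff n hxy fun B _ => B = A,
    exists_hook_iff n hxy fun B Y => B = A ∧ Continuation (unimodal 2 n) A Y Z]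

theorem replaces_segment_iff {M x y s t s' o' t' : ℕ} (hx : x ≤ M) (hy : y ≤ M) (ht : t < s)
    (hs : s ≤ M) : Replaces x y s' o' t' ∧ segment M t' s' = segment M t s ↔
      Replaces x y s' o' t' ∧ ((t' = t ∧ s' = s) ∨ (t' + s = M ∧ s' + t = M)) := by
  refine and_congr_right fun h => ?_
  obtain ⟨h1, h2, -⟩ := h
  rw [segment_eq_iff h2 (by omega) ht hs]
  omega

/-- The only candidate hooks are `s → t` and its mirror `n + 1 - t → n + 1 - s`. The first needs `s`
in the pair; the second needs `n + 1 - t` in the pair and `n + 1 - s` not already there. -/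
theorem continuation_twoRow_of_stuck {n x y s t : ℕ} (hxy : x ≠ y) (hx : x ≤ n + 1)
    (hy : y ≤ n + 1) (ht : t < s) (hs : s ≤ n + 1) (hxs : x ≠ s) (hys : y ≠ s)
    (hxt : x + t = n + 1 → y + s = n + 1) (hyt : y + t = n + 1 → x + s = n + 1)
    {Z : YoungDiagram} :
    Continuation (unimodal 2 n) (segment (n + 1) t s) (twoRow x y) Z ↔ Z = twoRow x y := by
  have key : ¬ ∃ s' o' t', Replaces x y s' o' t' ∧
      segment (n + 1) t' s' = segment (n + 1) t s := by
    rintro ⟨s', o', t', h⟩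
    rw [replaces_segment_iff hx hy ht hs] at h
    unfold Replaces at h
    omega
  rw [continuation_twoRow_iff hxy]
  constructor
  · rintro (h | ⟨s', o', t', h1, h2, -⟩)
    · exact h.2
    · exact (key ⟨s', o', t', h1, h2⟩).elim
  · exact fun h => Or.inl ⟨key, h⟩

/-- Here `x = n + 1 - t`, so the mirror hook is present and its removal is forced. -/
theorem continuation_twoRow_of_step {n x y s t : ℕ} (hxy : x ≠ y) (hx : x ≤ n + 1)
    (hy : y ≤ n + 1) (ht : t < s) (hs : s ≤ n + 1) (hys : y ≠ s)
    (hxt : x + t = n + 1) (hys' : y + s ≠ n + 1) {Z : YoungDiagram} :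
    Continuation (unimodal 2 n) (segment (n + 1) t s) (twoRow x y) Z ↔
      Continuation (unimodal 2 n) (segment (n + 1) t s) (twoRow (n + 1 - s) y) Z := by
  have hr : Replaces x y x y (n + 1 - s) ∧
      segment (n + 1) (n + 1 - s) x = segment (n + 1) t s := by
    rw [replaces_segment_iff hx hy ht hs]
    unfold Replaces
    omega
  rw [continuation_twoRow_iff hxy]
  constructor
  · rintro (h | ⟨s', o', t', h1, h2, h3⟩)
    · exact (h.1 ⟨_, _, _, hr⟩).elim
    · have h4 := (replaces_segment_iff hx hy ht hs).1 ⟨h1, h2⟩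
      unfold Replaces at h4
      obtain ⟨rfl, rfl⟩ : t' = n + 1 - s ∧ o' = y := by omega
      exact h3
  · exact fun h => Or.inr ⟨_, _, _, hr.1, hr.2, h⟩

/-- The pairs `{x, y}` that occur in the game on the `2 × n` rectangle, where `M = n + 1`. -/
def Admissible (M x y : ℕ) : Prop :=
  x ≠ y ∧ x ≤ M ∧ y ≤ M ∧ x + y ≠ M ∧ 2 * x ≠ M ∧ 2 * y ≠ M

/-- After `s → t` the mirror hook can start at `t` itself, if `2 * t = n + 1`, or at the other
member `o`, if `t + o = n + 1`. The first case amounts to lowering `s` to `n + 1 - s`, the second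
reflects the pair; otherwise the turn ends at once. -/
theorem turn_twoRow_iff {n x y : ℕ} (h : Admissible (n + 1) x y) {Z : YoungDiagram} :
    Turn (unimodal 2 n) (twoRow x y) Z ↔
      (∃ s o t, Replaces x y s o t ∧ Admissible (n + 1) t o ∧ Z = twoRow t o) ∨
      (n + 1 < x + y ∧ Z = twoRow (n + 1 - y) (n + 1 - x)) := by
  obtain ⟨hxy, hx, hy, hs, hx2, hy2⟩ := h
  have hplain {s o t : ℕ} (hr : Replaces x y s o t) (h2 : 2 * t ≠ n + 1) (h3 : t + o ≠ n + 1) :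
      Continuation (unimodal 2 n) (segment (n + 1) t s) (twoRow t o) Z ↔ Z = twoRow t o := by
    unfold Replaces at hr
    apply continuation_twoRow_of_stuck <;> omega
  have hcentre {s o t : ℕ} (hr : Replaces x y s o t) (h2 : 2 * t = n + 1) :
      Continuation (unimodal 2 n) (segment (n + 1) t s) (twoRow t o) Z ↔
        Z = twoRow (n + 1 - s) o := by
    unfold Replaces at hr
    rw [continuation_twoRow_of_step, continuation_twoRow_of_stuck] <;> omega
  have hflip {s o t : ℕ} (hr : Replaces x y s o t) (h2 : t + o = n + 1) :
      Continuation (unimodal 2 n) (segment (n + 1) t s) (twoRow t o) Z ↔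
        Z = twoRow (n + 1 - o) (n + 1 - s) := by
    unfold Replaces at hr
    rw [twoRow_comm t o, continuation_twoRow_of_step, continuation_twoRow_of_stuck,
      twoRow_comm, show n + 1 - o = t by omega] <;> omega
  rw [turn_twoRow_iff_replaces hxy]
  constructor
  · rintro ⟨s, o, t, hr, hZ⟩
    by_cases h2 : 2 * t = n + 1
    · refine Or.inl ⟨s, o, n + 1 - s, ?_, ?_, (hcentre hr h2).1 hZ⟩ <;>
        unfold Replaces at * <;> (try unfold Admissible) <;> omega
    by_cases h3 : t + o = n + 1
    · right
      rw [hflip hr h3] at hZ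
      rcases hr with ⟨⟨rfl, rfl⟩ | ⟨rfl, rfl⟩, h4, h5⟩
      · exact ⟨by omega, hZ⟩
      · exact ⟨by omega, hZ.trans (twoRow_comm _ _)⟩
    · refine Or.inl ⟨s, o, t, hr, ?_, (hplain hr h2 h3).1 hZ⟩
      unfold Replaces at hr
      unfold Admissible
      omega
  · rintro (⟨s, o, t, hr, ha, hZ⟩ | ⟨h1, hZ⟩)
    · exact ⟨s, o, t, hr, (hplain hr ha.2.2.2.2.1 ha.2.2.2.1).2 hZ⟩
    · have hr : Replaces x y x y (n + 1 - y) := by unfold Replaces; omega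
      exact ⟨x, y, n + 1 - y, hr, (hflip hr (by omega)).2 hZ⟩

/-! ### Removing the centre: pairs in an interval of even length -/

/-- The increasing enumeration of the numbers up to `n + 1` other than `(n + 1) / 2`. -/
def skipCentre (n x : ℕ) : ℕ := if x ≤ n / 2 then x else x + n % 2

/-- Moves of the pair `y < x` in `{0, …, 2 * k - 1}`; pairs with sum `2 * k - 1` do not occur. -/
def PairMove (k x y x' y' : ℕ) : Prop :=
  y' < x' ∧ x' + y' + 1 ≠ 2 * k ∧
    ((x' < x ∧ y' = y) ∨ (x' = y ∧ y' < x) ∨ (x' = x ∧ y' < y) ∨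
      (2 * k ≤ x + y ∧ x' + y + 1 = 2 * k ∧ y' + x + 1 = 2 * k))

def IsPair (k x y : ℕ) : Prop := y < x ∧ x < 2 * k ∧ x + y + 1 ≠ 2 * k

theorem IsPair.of_pairMove {k x y x' y' : ℕ} (h : IsPair k x y) (hm : PairMove k x y x' y') :
    IsPair k x' y' := by
  unfold IsPair PairMove at *
  omega

/-- The diagram that belongs to a pair. -/
def pairDiagram (n x y : ℕ) : YoungDiagram := twoRow (skipCentre n x) (skipCentre n y)

theorem pairDiagram_inj {n x y x' y' : ℕ} (h : y < x) (h' : y' < x')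
    (he : pairDiagram n x y = pairDiagram n x' y') : x = x' ∧ y = y' := by
  have := twoRow_inj (by unfold skipCentre; split_ifs <;> omega)
    (by unfold skipCentre; split_ifs <;> omega) he
  unfold skipCentre at this
  split_ifs at this <;> omega

theorem exists_skipCentre_eq {n a : ℕ} (ha : a ≤ n + 1) (h2 : 2 * a ≠ n + 1) :
    ∃ b < 2 * (n / 2 + 1), skipCentre n b = a := by
  by_cases h : a ≤ n / 2
  · exact ⟨a, by omega, by simp [skipCentre, h]⟩
  · exact ⟨a - n % 2, by omega, by unfold skipCentre; rw [if_neg] <;> omega⟩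

theorem skipCentre_spec (n : ℕ) {x : ℕ} (hx : x < 2 * (n / 2 + 1)) :
    skipCentre n x ≤ n + 1 ∧ 2 * skipCentre n x ≠ n + 1 ∧
      n + 1 - skipCentre n x = skipCentre n (2 * (n / 2 + 1) - 1 - x) := by
  unfold skipCentre
  split_ifs <;> omega

theorem skipCentre_lt_iff {n x y : ℕ} : skipCentre n x < skipCentre n y ↔ x < y := by
  unfold skipCentre
  split_ifs <;> omega

theorem skipCentre_add (n x y : ℕ) :
    (skipCentre n x + skipCentre n y = n + 1 ↔ x + y + 1 = 2 * (n / 2 + 1)) ∧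
      (n + 1 < skipCentre n x + skipCentre n y ↔ 2 * (n / 2 + 1) ≤ x + y) := by
  unfold skipCentre
  split_ifs <;> omega

theorem admissible_skipCentre {n x y : ℕ} (hx : x < 2 * (n / 2 + 1)) (hy : y < 2 * (n / 2 + 1)) :
    Admissible (n + 1) (skipCentre n x) (skipCentre n y) ↔
      x ≠ y ∧ x + y + 1 ≠ 2 * (n / 2 + 1) := by
  have h1 := skipCentre_spec n hx
  have h2 := skipCentre_spec n hy
  have h3 := skipCentre_add n x y
  have h4 := skipCentre_lt_iff (n := n) (x := x) (y := y)
  have h5 := skipCentre_lt_iff (n := n) (x := y) (y := x)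
  unfold Admissible
  omega

theorem turn_pairDiagram_iff {n x y : ℕ} (h : IsPair (n / 2 + 1) x y) {Z : YoungDiagram} :
    Turn (unimodal 2 n) (pairDiagram n x y) Z ↔
      ∃ x' y', PairMove (n / 2 + 1) x y x' y' ∧ Z = pairDiagram n x' y' := by
  obtain ⟨h1, h2, h3⟩ := h
  have hy : y < 2 * (n / 2 + 1) := by omega
  have hadd := (skipCentre_add n x y).2
  have hfx := (skipCentre_spec n h2).2.2
  have hfy := (skipCentre_spec n hy).2.2
  unfold pairDiagram
  rw [turn_twoRow_iff ((admissible_skipCentre h2 hy).2 ⟨h1.ne', h3⟩), hadd]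
  constructor
  · rintro (⟨s, o, t, ⟨hs, hts, hto⟩, ha, rfl⟩ | ⟨hlt, rfl⟩)
    · obtain ⟨t, ht, rfl⟩ := exists_skipCentre_eq ha.2.1 ha.2.2.2.2.1
      rcases hs with ⟨rfl, rfl⟩ | ⟨rfl, rfl⟩
      · rw [skipCentre_lt_iff] at hts
        rw [admissible_skipCentre ht hy] at ha
        rcases lt_or_gt_of_ne ha.1 with hty | hty
        · exact ⟨y, t, by unfold PairMove; omega, twoRow_comm _ _⟩
        · exact ⟨t, y, by unfold PairMove; omega, rfl⟩
      · rw [skipCentre_lt_iff] at hts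
        rw [admissible_skipCentre ht h2] at ha
        exact ⟨x, t, by unfold PairMove; omega, twoRow_comm _ _⟩
    · exact ⟨2 * (n / 2 + 1) - 1 - y, 2 * (n / 2 + 1) - 1 - x, by unfold PairMove; omega,
        by rw [hfx, hfy]⟩
  · rintro ⟨x', y', ⟨hlt, hne, hm⟩, rfl⟩
    rcases hm with ⟨hm, rfl⟩ | ⟨rfl, hm⟩ | ⟨rfl, hm⟩ | ⟨hle, hm, hm'⟩
    · have ha := (admissible_skipCentre (hm.trans h2) hy).2 ⟨hlt.ne', hne⟩
      exact Or.inl ⟨_, _, _, ⟨Or.inl ⟨rfl, rfl⟩, skipCentre_lt_iff.2 hm, ha.1⟩, ha, rfl⟩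
    · have ha := (admissible_skipCentre (hm.trans h2) hy).2 ⟨hlt.ne, by omega⟩
      exact Or.inl ⟨_, _, _, ⟨Or.inl ⟨rfl, rfl⟩, skipCentre_lt_iff.2 hm, ha.1⟩, ha,
        twoRow_comm _ _⟩
    · have ha := (admissible_skipCentre (hm.trans hy) h2).2 ⟨hlt.ne, by omega⟩
      exact Or.inl ⟨_, _, _, ⟨Or.inr ⟨rfl, rfl⟩, skipCentre_lt_iff.2 hm, ha.1⟩, ha,
        twoRow_comm _ _⟩
    · refine Or.inr ⟨hle, ?_⟩
      rw [hfx, hfy]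
      congr 2 <;> omega

theorem rectangle_eq_pairDiagram {n : ℕ} (hn : 2 ≤ n) :
    rectangle 2 n = pairDiagram n (2 * (n / 2) + 1) (2 * (n / 2)) := by
  ext ⟨i, j⟩
  unfold pairDiagram
  rw [YoungDiagram.mem_cells, YoungDiagram.mem_cells, mem_twoRow, ← YoungDiagram.mem_cells]
  simp only [rectangle, Finset.mem_product, Finset.mem_range]
  unfold skipCentre
  split_ifs <;> omega

theorem exists_pairDiagram_of_reachable {n : ℕ} (hn : 2 ≤ n) {Y : YoungDiagram}
    (h : Relation.ReflTransGen (Turn (unimodal 2 n)) (rectangle 2 n) Y) :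
    ∃ x y, IsPair (n / 2 + 1) x y ∧ Y = pairDiagram n x y := by
  induction h with
  | refl => exact ⟨_, _, by unfold IsPair; omega, rectangle_eq_pairDiagram hn⟩
  | tail _ ht ih =>
    obtain ⟨x, y, hp, rfl⟩ := ih
    obtain ⟨x', y', hm, rfl⟩ := (turn_pairDiagram_iff hp).1 ht
    exact ⟨x', y', hp.of_pairMove hm, rfl⟩

end HookGame

/-! ### From the game on pairs to the value of the start -/

open HookGame in
/-- A criterion for the value of the start of `MHRG 2 n`: relations `T 0, …, T V` on pairs that
behave like the relations of having value `0, …, V` determine it. -/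
theorem MHRG_gValue_start {n : ℕ} (hn : 2 ≤ n) (V : ℕ) (T : ℕ → ℕ → ℕ → Prop)
    (hdisj : ∀ v ≤ V, ∀ u < v, ∀ x y, T v x y → ¬ T u x y)
    (hindep : ∀ v ≤ V, ∀ x y x' y', IsPair (n / 2 + 1) x y → PairMove (n / 2 + 1) x y x' y' →
      T v x y → ¬ T v x' y')
    (habs : ∀ v ≤ V, ∀ x y, IsPair (n / 2 + 1) x y → (∀ u ≤ v, ¬ T u x y) →
      ∃ x' y', PairMove (n / 2 + 1) x y x' y' ∧ T v x' y')
    (hstart : T V (2 * (n / 2) + 1) (2 * (n / 2))) :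
    (MHRG 2 n).gValue (MHRG 2 n).start = V := by
  have hT {v x y : ℕ} (hxy : y < x) : (∃ x' y', y' < x' ∧
      pairDiagram n x y = pairDiagram n x' y' ∧ T v x' y') ↔ T v x y := by
    constructor
    · rintro ⟨x', y', h1, h2, h3⟩
      obtain ⟨rfl, rfl⟩ := pairDiagram_inj hxy h1 h2
      exact h3
    · exact fun h => ⟨x, y, hxy, rfl, h⟩
  refine ((MHRG 2 n).gValue_eq_iff_mem V
    (fun v => {p | ∃ x y, y < x ∧ p.1 = pairDiagram n x y ∧ T v x y}) ?_ ?_ ?_ _ V le_rfl).2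
    ⟨_, _, by omega, rectangle_eq_pairDiagram hn, hstart⟩
  · rintro v hv u hu p ⟨x, y, hxy, hp, h⟩ hp'
    rw [Set.mem_ofPred_eq, hp, hT hxy] at hp'
    exact hdisj v hv u hu x y h hp'
  · rintro v hv ⟨Y, hY⟩ ⟨x, y, hxy, hp, h⟩ ⟨Z, hZ⟩ hm ⟨x', y', hxy', hp', h'⟩
    obtain ⟨a, b, hab, rfl⟩ := exists_pairDiagram_of_reachable hn hY
    obtain ⟨rfl, rfl⟩ := pairDiagram_inj hab.1 hxy hp
    obtain ⟨c, d, hm', rfl⟩ := (turn_pairDiagram_iff hab).1 hm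
    obtain ⟨rfl, rfl⟩ := pairDiagram_inj hm'.1 hxy' hp'
    exact hindep v hv _ _ _ _ hab hm' h h'
  · rintro v hv ⟨Y, hY⟩ hp
    obtain ⟨x, y, hxy, rfl⟩ := exists_pairDiagram_of_reachable hn hY
    obtain ⟨x', y', hm, h⟩ := habs v hv x y hxy fun u hu hu' => hp u hu ((hT hxy.1).2 hu')
    have ht := (turn_pairDiagram_iff hxy).2 ⟨x', y', hm, rfl⟩
    exact ⟨⟨_, hY.tail ht⟩, ht, x', y', hm.1, rfl, h⟩

/-! ### The classes of pairs of value 0, 1 and 2 -/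

namespace HookGame

/-- The pairs of value `0`. -/
def ValueZero (k x y : ℕ) : Prop :=
  (x + y + 1 < 2 * k ∧ x = y + 1 ∧ y % 2 = 0) ∨
    (2 * k ≤ x + y ∧ x = y + 2 ∧ (y % 4 < 2 ↔ k % 4 < 2))

/-- The pairs of value `1`. -/
def ValueOne (k x y : ℕ) : Prop :=
  (x + y + 1 < 2 * k ∧ x = y + 2 ∧ y % 4 < 2) ∨
  (2 * k ≤ x + y ∧
    (((k % 4 = 0 ∨ k % 4 = 3) ∧ x = y + 1 ∧ y % 2 = 0) ∨
    (k % 4 = 1 ∧ ((x = y + 1 ∧ y % 2 = 0 ∧ k + 3 ≤ y) ∨ (x = k + 2 ∧ y + 1 = k) ∨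
      (x = k + 1 ∧ y = k))) ∨
    (k % 4 = 2 ∧ x = y + 3 ∧ y % 2 = 1)))

/-- The pairs of value `2` when `k` is at least `6` and congruent to `2` modulo `4`. -/
def ValueTwo (k x y : ℕ) : Prop :=
  (x + y + 1 < 2 * k ∧ ((x = y + 3 ∧ y % 4 = 0) ∨ (x = y + 1 ∧ y % 4 = 1))) ∨
  (2 * k ≤ x + y ∧ ((x = y + 1 ∧ y % 2 = 0 ∧ k + 4 ≤ y) ∨ (x = k + 3 ∧ y = k) ∨
    (x = k + 2 ∧ y + 2 = k) ∨ (x = k + 1 ∧ y + 1 = k)))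

variable {k x y : ℕ}

/-- A lowering move keeps one member, which has at most one partner in the class. Reflection keeps
the difference, which is `2` for the upper pairs and `1` for the lower ones. -/
theorem ValueZero.not_pairMove {x' y' : ℕ} (h : ValueZero k x y) (hm : PairMove k x y x' y') :
    ¬ ValueZero k x' y' := by
  unfold PairMove ValueZero at *
  omega

theorem ValueOne.not_pairMove {x' y' : ℕ} (h : ValueOne k x y) (hm : PairMove k x y x' y') :
    ¬ ValueOne k x' y' := by
  obtain ⟨h1, h2, h3⟩ := hm
  unfold ValueOne at *
  rcases h3 with h3 | h3 | h3 | h3 <;> omega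

/-- Near the middle, the pairs `{k - 2, k + 2}`, `{k - 1, k + 1}`, `{k, k + 3}` repair the matching
where the lower pattern would produce the forbidden sum `2k - 1`. Reflected upper pairs have the
wrong difference or the wrong residue modulo `4`. -/
theorem ValueTwo.not_pairMove {x' y' : ℕ} (hk : k % 4 = 2) (h : ValueTwo k x y)
    (hm : PairMove k x y x' y') : ¬ ValueTwo k x' y' := by
  obtain ⟨h1, h2, h3⟩ := hm
  unfold ValueTwo at *
  rcases h3 with h3 | h3 | h3 | h3 <;> omega

theorem ValueOne.not_valueZero (h : ValueOne k x y) : ¬ ValueZero k x y := by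
  unfold ValueZero ValueOne at *
  omega

theorem ValueTwo.not_valueZero (hk : k % 4 = 2) (h : ValueTwo k x y) : ¬ ValueZero k x y := by
  unfold ValueZero ValueTwo at *
  omega

theorem ValueTwo.not_valueOne (hk : k % 4 = 2) (h : ValueTwo k x y) : ¬ ValueOne k x y := by
  unfold ValueOne ValueTwo at *
  omega

/-- Let `z` be the partner of the smaller member `y`. If `z < x`, replacing `x` by `z` works;
otherwise the partner of `x` or a reflection does. -/
theorem exists_pairMove_valueZero (hp : IsPair k x y) (h0 : ¬ ValueZero k x y) :
    ∃ x' y', PairMove k x y x' y' ∧ ValueZero k x' y' := by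
  unfold IsPair PairMove ValueZero at *
  by_cases h1 : y % 2 = 0 ∧ y + 1 < k
  · exact ⟨y + 1, y, by omega⟩
  by_cases h2 : y % 2 = 1 ∧ y < k
  · exact ⟨y, y - 1, by omega⟩
  by_cases h3 : y % 4 < 2 ↔ k % 4 < 2
  · by_cases h4 : y + 2 < x
    · exact ⟨y + 2, y, by omega⟩
    · by_cases h5 : y % 2 = 0
      -- Here `x = y + 1` with `y` even, so the partner `y + 2` is out of reach; the reflected pair
      -- is a lower pair with even smaller member.
      · exact ⟨2 * k - 1 - y, 2 * k - 1 - x, by omega⟩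
      · exact ⟨x, y - 1, by omega⟩
  · exact ⟨y, y - 2, by omega⟩

theorem pairMove_above {t : ℕ} (hy : y < t) (hx : t < x) :
    t + y + 1 ≠ 2 * k → PairMove k x y t y := by
  unfold PairMove
  omega

theorem IsPair.move_across (hp : IsPair k x y) {t : ℕ} (hy : t < y) :
    y + t + 1 ≠ 2 * k → PairMove k x y y t := by
  unfold IsPair PairMove at *
  omega

theorem IsPair.move_below (hp : IsPair k x y) {t : ℕ} (hy : t < y) :
    x + t + 1 ≠ 2 * k → PairMove k x y x t := by
  unfold IsPair PairMove at *
  omega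

theorem IsPair.move_reflect (hp : IsPair k x y) (h : 2 * k ≤ x + y) :
    PairMove k x y (2 * k - 1 - y) (2 * k - 1 - x) := by
  unfold IsPair PairMove at *
  omega

theorem exists_pairMove_valueOne (hp : IsPair k x y) (h0 : ¬ ValueZero k x y)
    (h1 : ¬ ValueOne k x y) : ∃ x' y', PairMove k x y x' y' ∧ ValueOne k x' y' := by
  obtain ⟨hxy, hx, hne⟩ := id hp
  by_cases h2 : y % 4 < 2 ∧ y + 1 < k
  · obtain h3 | h3 | h3 : y + 2 < x ∨ x = y + 2 ∨ x = y + 1 := by omega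
    · exact ⟨y + 2, y, pairMove_above (by omega) h3 (by omega), Or.inl (by omega)⟩
    · exact (h1 (Or.inl (by omega))).elim
    · by_cases h4 : y % 4 = 0
      · exact (h0 (Or.inl (by omega))).elim
      · exact ⟨x, y - 1, hp.move_below (by omega) (by omega), Or.inl (by omega)⟩
  by_cases h3 : 2 ≤ y % 4 ∧ y ≤ k
  · exact ⟨y, y - 2, hp.move_across (by omega) (by omega), Or.inl (by omega)⟩
  obtain hk | hk | hk : (k % 4 = 0 ∨ k % 4 = 3) ∨ k % 4 = 1 ∨ k % 4 = 2 := by omega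
  · by_cases h4 : y % 2 = 0
    · by_cases h5 : x = y + 1
      · exact (h1 (Or.inr (by omega))).elim
      · exact ⟨y + 1, y, pairMove_above (by omega) (by omega) (by omega), Or.inr (by omega)⟩
    · exact ⟨y, y - 1, hp.move_across (by omega) (by omega), Or.inr (by omega)⟩
  · obtain ⟨h4, h5⟩ | ⟨h4, h5⟩ | h4 | h4 | h4 | h4 : (k + 3 ≤ y ∧ y % 2 = 0) ∨
        (k + 3 ≤ y ∧ y % 2 = 1) ∨ y = k + 1 ∨ y = k + 2 ∨ y + 1 = k ∨ y = k := by omega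
    · by_cases h6 : x = y + 1
      · exact (h1 (Or.inr (by omega))).elim
      · exact ⟨y + 1, y, pairMove_above (by omega) (by omega) (by omega), Or.inr (by omega)⟩
    · exact ⟨y, y - 1, hp.move_across (by omega) (by omega), Or.inr (by omega)⟩
    · exact ⟨y, k, hp.move_across (by omega) (by omega), Or.inr (by omega)⟩
    · exact ⟨y, k - 1, hp.move_across (by omega) (by omega), Or.inr (by omega)⟩
    · obtain h5 | h5 | h5 : x = k + 1 ∨ x = k + 2 ∨ k + 2 < x := by omega
      · exact (h0 (Or.inr (by omega))).elim
      · exact (h1 (Or.inr (by omega))).elim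
      · exact ⟨k + 2, y, pairMove_above (by omega) (by omega) (by omega), Or.inr (by omega)⟩
    · by_cases h5 : x = k + 1
      · exact (h1 (Or.inr (by omega))).elim
      · exact ⟨k + 1, y, pairMove_above (by omega) (by omega) (by omega), Or.inr (by omega)⟩
  · by_cases h4 : y % 2 = 1
    · obtain h5 | h5 | h5 | h5 : y + 3 < x ∨ x = y + 3 ∨ x = y + 2 ∨ x = y + 1 := by omega
      · exact ⟨y + 3, y, pairMove_above (by omega) h5 (by omega), Or.inr (by omega)⟩
      · exact (h1 (Or.inr (by omega))).elim
      · by_cases h6 : y % 4 = 1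
        -- With `x = y + 2` and `y ≡ 1`, `k ≡ 2` modulo `4`, the reflected smaller member `2k - 3 -
        -- y` is divisible by `4`.
        · exact ⟨_, _, hp.move_reflect (by omega), Or.inl (by omega)⟩
        · exact (h0 (Or.inr (by omega))).elim
      · exact ⟨x, y - 2, hp.move_below (by omega) (by omega), Or.inr (by omega)⟩
    · exact ⟨y, y - 3, hp.move_across (by omega) (by omega), Or.inr (by omega)⟩

theorem exists_pairMove_valueTwo (hk : k % 4 = 2) (hp : IsPair k x y)
    (h0 : ¬ ValueZero k x y) (h1 : ¬ ValueOne k x y) (h2 : ¬ ValueTwo k x y) :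
    ∃ x' y', PairMove k x y x' y' ∧ ValueTwo k x' y' := by
  obtain ⟨hxy, hx, hne⟩ := id hp
  by_cases h3 : y + 2 < k
  · obtain h4 | h4 | h4 | h4 : y % 4 = 0 ∨ y % 4 = 1 ∨ y % 4 = 2 ∨ y % 4 = 3 := by omega
    · obtain h5 | h5 | h5 | h5 : y + 3 < x ∨ x = y + 3 ∨ x = y + 2 ∨ x = y + 1 := by omega
      · exact ⟨y + 3, y, pairMove_above (by omega) h5 (by omega), Or.inl (by omega)⟩
      · exact (h2 (Or.inl (by omega))).elim
      · exact (h1 (Or.inl (by omega))).elim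
      · exact (h0 (Or.inl (by omega))).elim
    · by_cases h5 : x = y + 1
      · exact (h2 (Or.inl (by omega))).elim
      · exact ⟨y + 1, y, pairMove_above (by omega) (by omega) (by omega), Or.inl (by omega)⟩
    · exact ⟨y, y - 1, hp.move_across (by omega) (by omega), Or.inl (by omega)⟩
    · exact ⟨y, y - 3, hp.move_across (by omega) (by omega), Or.inl (by omega)⟩
  obtain ⟨h4, h5⟩ | ⟨h4, h5⟩ | h4 | h4 | h4 | h4 | h4 | h4 : (k + 4 ≤ y ∧ y % 2 = 0) ∨
      (k + 4 ≤ y ∧ y % 2 = 1) ∨ y = k + 3 ∨ y = k + 2 ∨ y = k + 1 ∨ y = k ∨ y + 1 = k ∨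
      y + 2 = k := by omega
  · by_cases h6 : x = y + 1
    · exact (h2 (Or.inr (by omega))).elim
    · exact ⟨y + 1, y, pairMove_above (by omega) (by omega) (by omega), Or.inr (by omega)⟩
  · exact ⟨y, y - 1, hp.move_across (by omega) (by omega), Or.inr (by omega)⟩
  · exact ⟨y, k, hp.move_across (by omega) (by omega), Or.inr (by omega)⟩
  · exact ⟨y, k - 2, hp.move_across (by omega) (by omega), Or.inr (by omega)⟩
  · exact ⟨y, k - 1, hp.move_across (by omega) (by omega), Or.inr (by omega)⟩
  · obtain h5 | h5 | h5 | h5 : k + 3 < x ∨ x = k + 3 ∨ x = k + 2 ∨ x = k + 1 := by omega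
    · exact ⟨k + 3, y, pairMove_above (by omega) h5 (by omega), Or.inr (by omega)⟩
    · exact (h2 (Or.inr (by omega))).elim
    · exact (h0 (Or.inr (by omega))).elim
    · exact ⟨x, k - 1, hp.move_below (by omega) (by omega), Or.inr (by omega)⟩
  · by_cases h5 : x = k + 1
    · exact (h2 (Or.inr (by omega))).elim
    · exact ⟨k + 1, y, pairMove_above (by omega) (by omega) (by omega), Or.inr (by omega)⟩
  · obtain h5 | h5 | h5 | h5 : k + 2 < x ∨ x = k + 2 ∨ x = k ∨ x + 1 = k := by omega
    · exact ⟨k + 2, y, pairMove_above (by omega) h5 (by omega), Or.inr (by omega)⟩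
    · exact (h2 (Or.inr (by omega))).elim
    · exact (h1 (Or.inl (by omega))).elim
    · exact (h0 (Or.inl (by omega))).elim

/-- For `k = 2` only four pairs exist, and the one left over is the start; this is the source of the
exceptional value `3`. -/
theorem valueZero_or_valueOne_or_valueTwo_of_eq_two (hp : IsPair 2 x y) :
    ValueZero 2 x y ∨ ValueOne 2 x y ∨ ValueTwo 2 x y ∨ (x = 3 ∧ y = 2) := by
  obtain ⟨h1, h2, h3⟩ := hp
  obtain h | h | h | h : (x = 1 ∧ y = 0) ∨ (x = 2 ∧ y = 0) ∨ (x = 3 ∧ y = 1) ∨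
      (x = 3 ∧ y = 2) := by omega
  · exact Or.inl (Or.inl (by omega))
  · exact Or.inr (Or.inl (Or.inl (by omega)))
  · exact Or.inr (Or.inr (Or.inl (Or.inr (by omega))))
  · exact Or.inr (Or.inr (Or.inr h))

/-- The pairs of value `v`. The value `3` is only considered for `k = 2`. -/
def HasValue (k : ℕ) : ℕ → ℕ → ℕ → Prop
  | 0 => ValueZero k
  | 1 => ValueOne k
  | 2 => ValueTwo k
  | _ => fun x y => x = 3 ∧ y = 2

theorem HasValue.not_hasValue {v u : ℕ} (hv : v = 1 ∨ (v = 2 ∧ k % 4 = 2) ∨ (v = 3 ∧ k = 2))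
    (hu : u < v) (h : HasValue k v x y) : ¬ HasValue k u x y := by
  rcases hv with rfl | ⟨rfl, hk⟩ | ⟨rfl, rfl⟩
  · obtain rfl : u = 0 := by omega
    exact ValueOne.not_valueZero h
  · obtain rfl | rfl : u = 0 ∨ u = 1 := by omega
    · exact ValueTwo.not_valueZero hk h
    · exact ValueTwo.not_valueOne hk h
  · obtain ⟨rfl, rfl⟩ := h
    interval_cases u
    · simp [HasValue, ValueZero]
    · simp [HasValue, ValueOne]
    · simp [HasValue, ValueTwo]

theorem HasValue.not_pairMove {v x' y' : ℕ} (hv : v ≤ 1 ∨ (v = 2 ∧ k % 4 = 2) ∨ (v = 3 ∧ k = 2))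
    (hm : PairMove k x y x' y') (h : HasValue k v x y) : ¬ HasValue k v x' y' := by
  obtain rfl | rfl | ⟨rfl, hk⟩ | ⟨rfl, rfl⟩ : v = 0 ∨ v = 1 ∨ (v = 2 ∧ k % 4 = 2) ∨
      (v = 3 ∧ k = 2) := by omega
  · exact ValueZero.not_pairMove h hm
  · exact ValueOne.not_pairMove h hm
  · exact ValueTwo.not_pairMove hk h hm
  · obtain ⟨rfl, rfl⟩ := h
    rintro ⟨rfl, rfl⟩
    simp [PairMove] at hm

theorem exists_pairMove_hasValue {v : ℕ} (hv : v ≤ 1 ∨ (v = 2 ∧ k % 4 = 2) ∨ (v = 3 ∧ k = 2))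
    (hp : IsPair k x y) (h : ∀ u ≤ v, ¬ HasValue k u x y) :
    ∃ x' y', PairMove k x y x' y' ∧ HasValue k v x' y' := by
  obtain rfl | rfl | ⟨rfl, hk⟩ | ⟨rfl, rfl⟩ : v = 0 ∨ v = 1 ∨ (v = 2 ∧ k % 4 = 2) ∨
      (v = 3 ∧ k = 2) := by omega
  · exact exists_pairMove_valueZero hp (h 0 le_rfl)
  · exact exists_pairMove_valueOne hp (h 0 zero_le_one) (h 1 le_rfl)
  · exact exists_pairMove_valueTwo hk hp (h 0 (by omega)) (h 1 (by omega)) (h 2 le_rfl)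
  · rcases valueZero_or_valueOne_or_valueTwo_of_eq_two hp with h' | h' | h' | h'
    · exact (h 0 (by omega) h').elim
    · exact (h 1 (by omega) h').elim
    · exact (h 2 (by omega) h').elim
    · exact (h 3 le_rfl h').elim

end HookGame

/-! ### Locating the start among the classes -/

open HookGame in
theorem MHRG_gValue_start_of_hasValue {n V : ℕ} (hn : 2 ≤ n)
    (hV : V = 1 ∨ (V = 2 ∧ n / 2 % 4 = 1) ∨ (V = 3 ∧ n / 2 = 1))
    (h : HasValue (n / 2 + 1) V (2 * (n / 2) + 1) (2 * (n / 2))) :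
    (MHRG 2 n).gValue (MHRG 2 n).start = V :=
  MHRG_gValue_start hn V (HasValue (n / 2 + 1))
    (fun _ hv _ hu _ _ h => h.not_hasValue (by omega) hu)
    (fun _ hv _ _ _ _ _ hm h => h.not_pairMove (by omega) hm)
    (fun _ hv _ _ hp h => exists_pairMove_hasValue (by omega) hp h) h

theorem corollary4p14 (n : ℕ) (hn : 2 ≤ n) :
    (MHRG 2 n).gValue (MHRG 2 n).start =
      if n = 2 ∨ n = 3 then 3
      else if n ≡ 2 [MOD 8] ∨ n ≡ 3 [MOD 8] then 2
      else 1 := by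
  unfold Nat.ModEq
  split_ifs with h1 h2
  · exact MHRG_gValue_start_of_hasValue hn (by omega) ⟨by omega, by omega⟩
  -- The bound `k + 4 ≤ 2k - 2` in class `2` holds because `k ≡ 2 mod 4` and `k ≠ 2` give `k ≥ 6`.
  · exact MHRG_gValue_start_of_hasValue hn (by omega) (Or.inr (by omega))
  · exact MHRG_gValue_start_of_hasValue hn (by omega) (Or.inr (by omega))
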